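/- There is a universal constant $C>0$ such that the following holds. Let $d\ge 0$, $n,K\ge 1$ with $nK\ge 2$, $1\le r\le M$, $\theta\in(0,1]$ and $\rho>0$. Let $\nu_1,\dots,\nu_M$ be probability distributions on $\mathbb R^d\times\{-1,+1\}$ and $a_1,\dots,a_M\in\mathbb R^d$ such that $\|X-a_m\|\le\rho$ almost surely when $(X,Y)\sim\nu_m$. In the $r$-th heterogeneity setup, put $c_k=(k \bmod (M-r+1))+1$ for $k\in\{1,\dots,K\}$; client $k$ has the data distribution $$\mu_k=\sum_{m=c_k}^{c_k+r-1}\alpha_{k,m}\,\nu_m ,$$ where the coefficients $\alpha_{k,m}\ge 0$ satisfy $\sum_{m=c_k}^{c_k+r-1}\alpha_{k,m}=1$ for every $k$ (the setup usually imposes in addition $K\ge M$, $\sum_k\alpha_{k,m}=K/M$ for every $m$, and $\alpha_{k,m}=\alpha_{k',m}$ whenever $c_k=c_{k'}$; the result does not need this). Client $k$ draws a dataset $S_k=((X_{k,i},Y_{k,i}))_{i=1}^n$ of $n$ i.i.d. samples from $\mu_k$ and produces from $S_k$, by an arbitrary, possibly randomized learning algorithm, the weight vector $W_k\in\mathbb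 R^d$, $\|W_k\|\le 1$ almost surely, of a linear classifier $x\mapsto \operatorname{sign}\langle x,W_k\rangle$; the pairs $(S_k,W_k)$ are independent across clients. The aggregated model is $\overline W=\frac1K\sum_{k=1}^K W_k$, and its margin generalization error is $$\mathrm{gen}_\theta(S_{[K]},\overline W)=\frac1K\sum_{k=1}^K\Big(\mathbb P_{(X,Y)\sim\mu_k}\big[Y\langle X,\overline W\rangle<0\big]-\frac1n\sum_{i=1}^n \mathbf 1\{Y_{k,i}\langle X_{k,i},\overline W\rangle<\theta\}\Big),$$ where $(X,Y)$ is independent of $\overline W$. Then $\mathrm{gen}_\theta(S_{[K]},\overline W)$ is integrable and $$\mathbb E\big[\mathrm{gen}_\theta(S_{[K]},\overline W)\big]\le C\sqrt{\frac{1}{nK}\sum_{k=1}^K\left[\Big(\frac{\rho_k}{K\theta}\Big)^2\log(nK)\,\log\max\Big(3,\frac{K\theta}{\rho_k}\Big)+\log\max\Big(1,\frac{4n\|b_k\|}{K\theta}\Big)\right]},$$ where $$\rho_k=\rho+D_{k,r},\qquad D_{k,r}=\max_{c_k\le i,j\le c_k+r-1}\|a_i-a_j\|,\qquad b_k=\sum_{m=c_k}^{c_k+r-1}\alpha_{k,m}a_m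 .$$ -/

import Mathlib

open MeasureTheory ProbabilityTheory

open scoped NNReal

noncomputable section

namespace DSVM

/-- Feature vectors, and also weight vectors of linear classifiers: `ℝ^d` with the Euclidean norm. -/
abbrev Vec (d : ℕ) : Type := EuclideanSpace ℝ (Fin d)

/-- Binary labels `{-1, +1}`. -/
abbrev Label : Type := ({-1, 1} : Set ℝ)

/-- Labelled data points `(x, y)`. -/
abbrev Datum (d : ℕ) : Type := Vec d × Label

/-- The 0-1 loss with margin `γ` of the linear classifier `x ↦ ⟨x, w⟩`:
`1` if `y ⟨x, w⟩ < γ`, and `0` otherwise. The plain 0-1 loss is the case `γ = 0`. -/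
def marginLoss {d : ℕ} (γ : ℝ) (z : Datum d) (w : Vec d) : ℝ :=
  open Classical in if (z.2 : ℝ) * inner ℝ z.1 w < γ then 1 else 0

/-- Population risk under `μ` (plain 0-1 loss). -/
def popRisk {d : ℕ} (μ : Measure (Datum d)) (w : Vec d) : ℝ :=
  ∫ z, marginLoss 0 z w ∂μ

/-- Empirical risk on a dataset of size `n` (0-1 loss with margin `θ`). -/
def empRisk {d n : ℕ} (θ : ℝ) (s : Fin n → Datum d) (w : Vec d) : ℝ :=
  (1 / (n : ℝ)) * ∑ i, marginLoss θ (s i) w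

/-- The server's model: the arithmetic average of the clients' models. -/
def aggregate {d K : ℕ} (w : Fin K → Vec d) : Vec d :=
  (1 / (K : ℝ)) • ∑ k, w k

/-- Margin generalization error of the aggregated model, averaged over the clients.
An outcome `ω` lists, for every client `k`, its dataset `(ω k).1` and its model `(ω k).2`. -/
def genError {d n K : ℕ} (θ : ℝ) (μ : Fin K → Measure (Datum d))
    (ω : Fin K → (Fin n → Datum d) × Vec d) : ℝ :=
  (1 / (K : ℝ)) * ∑ k, (popRisk (μ k) (aggregate fun j => (ω j).2)
    - empRisk θ (ω k).1 (aggregate fun j => (ω j).2))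

/-- Joint law of the dataset (`n` i.i.d. samples from `μ`) and of the model of one client that uses
the possibly stochastic learning algorithm `A`. -/
def clientLaw {d n : ℕ} (μ : Measure (Datum d)) (A : Kernel (Fin n → Datum d) (Vec d)) :
    Measure ((Fin n → Datum d) × Vec d) :=
  (Measure.pi fun _ : Fin n => μ) ⊗ₘ A

/-- Joint law of the datasets and models of all clients, which are independent across clients. -/
def systemLaw {d n K : ℕ} (μ : Fin K → Measure (Datum d))
    (A : Fin K → Kernel (Fin n → Datum d) (Vec d)) :
    Measure (Fin K → (Fin n → Datum d) × Vec d) :=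
  Measure.pi fun k => clientLaw (μ k) (A k)

/-- The first index `(k mod (M - r + 1)) + 1` of the window of the `k`-th client in the `r`-th setup,
with clients and distributions numbered from `1`. -/
def windowStart (M r k : ℕ) : ℕ := k % (M - r + 1) + 1

/-- The `r` consecutive indices `c, …, c + r - 1`, `c = windowStart M r k`, of the distributions that
the `k`-th client mixes. The element `m : Fin M` stands for the distribution number `m + 1`, and
the element `k : Fin K` for the client number `k + 1`. -/
def window {K : ℕ} (M r : ℕ) (k : Fin K) : Finset (Fin M) :=
  Finset.univ.filter fun m =>
    (m : ℕ) + 1 ∈ Finset.Icc (windowStart M r (k + 1)) (windowStart M r (k + 1) + r - 1)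

/-- The data distribution of client `k` in the `r`-th setup. -/
def setupDist {d K M : ℕ} (r : ℕ) (ν : Fin M → Measure (Datum d)) (α : Fin K → Fin M → ℝ≥0)
    (k : Fin K) : Measure (Datum d) :=
  ∑ m ∈ window M r k, α k m • ν m

/-- The largest distance between two ball centers in the window of client `k`. -/
def spread {d K M : ℕ} (r : ℕ) (a : Fin M → Vec d) (k : Fin K) : ℝ :=
  ((window M r k ×ˢ window M r k).sup fun p => ‖a p.1 - a p.2‖₊ : ℝ≥0)

/-- The mean of the ball centers in the window of client `k`. -/
def center {d K M : ℕ} (r : ℕ) (a : Fin M → Vec d) (α : Fin K → Fin M → ℝ≥0) (k : Fin K) : Vec d :=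
  ∑ m ∈ window M r k, (α k m : ℝ) • a m

end DSVM

end

/-! The bound is a Rademacher complexity estimate, one client at a time.

Write the aggregated model as `v + w / K`, where `w` is the model of client `k` and `v` collects the
models of the others. By independence `v` may be held fixed when the expectation over the data and
the model of client `k` is taken. The data of client `k` lie within `ρ_k` of `b_k`, so
`⟪x, v + w / K⟫ = ⟪x, v⟫ + ⟪b_k, w⟫ / K + ⟪x - b_k, w⟫ / K`
is a fixed function, plus a scalar offset in `[-‖b_k‖ / K, ‖b_k‖ / K]`, plus a linear function of norm
at most `ρ_k / K`. The margin `θ` leaves room for rounding the offset to a grid of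
`N ≲ max(1, ‖b_k‖ / (K θ))` points and `w` to a finite net, and for putting a ramp loss, Lipschitz
with constant `3 / θ`, between the two 0-1 losses (`exists_surrogate_class`). Hence the contribution
of client `k` is at most the largest deviation over a finite class of surrogates. Symmetrization
(`integral_ciSup_deviation_le`) reduces this to Rademacher averages. For one offset these are at most
`3 ρ_k √n / (K θ)`, by the contraction principle (`signAvg_contraction`) and orthogonality of the
signs (`signAvg_linear_le`). The maximum over the offsets costs only the additive term
`√(2 n log N)` (`signAvg_ciSup_prod_le`), because every Rademacher average is sub-Gaussian around its
mean (`signAvg_exp_ciSup_le`). This gives a contribution of order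
`√(((ρ_k / (K θ)) ^ 2 + log N) / n)`, and concavity of the square root takes care of the average over
the clients. The logarithmic factors multiplying `(ρ_k / (K θ)) ^ 2` in the statement are only used
through being bounded below. -/

namespace DSVM

/-! ### Averages over random signs -/

/-- The average of `F` over the `2 ^ n` sign vectors in `{1, -1} ^ n`, computed one coordinate at a
time so that statements about it follow by induction on `n`. -/
noncomputable def signAvg : (n : ℕ) → ((Fin n → ℝ) → ℝ) → ℝ
  | 0, F => F Fin.elim0
  | n + 1, F =>
      (signAvg n (fun ε => F (Fin.cons 1 ε)) + signAvg n fun ε => F (Fin.cons (-1) ε)) / 2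

lemma signAvg_mono {n : ℕ} {F G : (Fin n → ℝ) → ℝ}
    (h : ∀ ε : Fin n → ℝ, (∀ i, ε i = 1 ∨ ε i = -1) → F ε ≤ G ε) :
    signAvg n F ≤ signAvg n G := by
  induction n with
  | zero => exact h _ fun i => i.elim0
  | succ n ih =>
    have h1 := ih (F := fun ε => F (Fin.cons 1 ε)) (G := fun ε => G (Fin.cons 1 ε))
      fun ε hε => h _ fun i => by refine Fin.cases ?_ ?_ i <;> simp [hε]
    have h2 := ih (F := fun ε => F (Fin.cons (-1) ε)) (G := fun ε => G (Fin.cons (-1) ε))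
      fun ε hε => h _ fun i => by refine Fin.cases ?_ ?_ i <;> simp [hε]
    simp only [signAvg]
    linarith

lemma signAvg_congr {n : ℕ} {F G : (Fin n → ℝ) → ℝ}
    (h : ∀ ε : Fin n → ℝ, (∀ i, ε i = 1 ∨ ε i = -1) → F ε = G ε) :
    signAvg n F = signAvg n G :=
  le_antisymm (signAvg_mono fun ε hε => (h ε hε).le) (signAvg_mono fun ε hε => (h ε hε).ge)

lemma signAvg_add {n : ℕ} (F G : (Fin n → ℝ) → ℝ) :
    signAvg n (fun ε => F ε + G ε) = signAvg n F + signAvg n G := by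
  induction n with
  | zero => rfl
  | succ n ih => simp only [signAvg, ih]; ring

lemma signAvg_mul_left {n : ℕ} (c : ℝ) (F : (Fin n → ℝ) → ℝ) :
    signAvg n (fun ε => c * F ε) = c * signAvg n F := by
  induction n with
  | zero => rfl
  | succ n ih => simp only [signAvg, ih]; ring

lemma signAvg_const {n : ℕ} (c : ℝ) : signAvg n (fun _ => c) = c := by
  induction n with
  | zero => rfl
  | succ n ih => simp only [signAvg, ih]; ring

lemma signAvg_sum {n : ℕ} {ι : Type*} (s : Finset ι) (F : ι → (Fin n → ℝ) → ℝ) :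
    signAvg n (fun ε => ∑ j ∈ s, F j ε) = ∑ j ∈ s, signAvg n (F j) := by
  induction s using Finset.cons_induction with
  | empty => simpa using signAvg_const 0
  | cons a s ha ih => simp only [Finset.sum_cons, signAvg_add, ih]

/-- Jensen's inequality for `exp`. -/
lemma exp_signAvg_le {n : ℕ} (F : (Fin n → ℝ) → ℝ) :
    Real.exp (signAvg n F) ≤ signAvg n fun ε => Real.exp (F ε) := by
  have h := signAvg_mono (n := n)
    (F := fun ε => Real.exp (signAvg n F) * (F ε + (1 - signAvg n F)))
    (G := fun ε => Real.exp (F ε)) fun ε _ => by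
      have h1 := Real.add_one_le_exp (F ε - signAvg n F)
      have h2 : Real.exp (F ε) = Real.exp (signAvg n F) * Real.exp (F ε - signAvg n F) := by
        rw [← Real.exp_add]; ring_nf
      rw [h2]
      exact mul_le_mul_of_nonneg_left (by linarith) (Real.exp_pos _).le
  rw [signAvg_mul_left, signAvg_add, signAvg_const] at h
  linarith

/-- Jensen's inequality for the square, in the form of a bound on the mean. -/
lemma signAvg_le_sqrt {n : ℕ} (F : (Fin n → ℝ) → ℝ) :
    signAvg n F ≤ √(signAvg n fun ε => F ε ^ 2) := by
  refine Real.le_sqrt_of_sq_le ?_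
  set m := signAvg n F with hm
  have h := signAvg_mono (n := n) (F := fun ε => (2 * m) * F ε + -m ^ 2)
    (G := fun ε => F ε ^ 2) fun ε _ => by nlinarith [sq_nonneg (F ε - m)]
  rw [signAvg_add, signAvg_const, signAvg_mul_left, ← hm] at h
  linarith

section Suprema

variable {T : Type*}

/-- The maximum over a finite class moves by at most the uniform distance. -/
lemma ciSup_le_ciSup_add [Finite T] [Nonempty T] {f g : T → ℝ} {c : ℝ} (h : ∀ t, f t ≤ g t + c) :
    ⨆ t, f t ≤ (⨆ t, g t) + c :=
  ciSup_le fun t => (h t).trans <|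
    add_le_add_left (le_ciSup (Set.finite_range g).bddAbove t) c

/-- One step of the contraction principle: for a single sign, the coefficients `f` may be replaced
by coefficients `g` whose increments are larger. -/
lemma ciSup_add_sub_le [Finite T] [Nonempty T] (h f g : T → ℝ)
    (hfg : ∀ s t, |f s - f t| ≤ |g s - g t|) :
    (⨆ t, (h t + f t)) + (⨆ t, (h t - f t)) ≤ (⨆ t, (h t + g t)) + ⨆ t, (h t - g t) := by
  obtain ⟨s, hs⟩ := exists_eq_ciSup_of_finite (f := fun t => h t + f t)
  obtain ⟨t, ht⟩ := exists_eq_ciSup_of_finite (f := fun t => h t - f t)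
  rw [← hs, ← ht]
  have bp : ∀ u, h u + g u ≤ ⨆ t, (h t + g t) := fun u =>
    le_ciSup (Set.finite_range fun t => h t + g t).bddAbove u
  have bm : ∀ u, h u - g u ≤ ⨆ t, (h t - g t) := fun u =>
    le_ciSup (Set.finite_range fun t => h t - g t).bddAbove u
  have h1 := (le_abs_self _).trans (hfg s t)
  rcases le_total 0 (g s - g t) with h0 | h0
  · rw [abs_of_nonneg h0] at h1
    linarith [bp s, bm t]
  · rw [abs_of_nonpos h0] at h1
    linarith [bp t, bm s]

/-- The Ledoux–Talagrand contraction principle for Rademacher averages. -/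
lemma signAvg_contraction [Finite T] [Nonempty T] {n : ℕ} (h : T → ℝ) (f g : Fin n → T → ℝ)
    (hfg : ∀ i s t, |f i s - f i t| ≤ |g i s - g i t|) :
    signAvg n (fun ε => ⨆ t, (h t + ∑ i, ε i * f i t)) ≤
      signAvg n fun ε => ⨆ t, (h t + ∑ i, ε i * g i t) := by
  induction n generalizing h with
  | zero => simp [signAvg]
  | succ n ih =>
    simp only [signAvg, Fin.sum_univ_succ, Fin.cons_zero, Fin.cons_succ, ← add_assoc]
    have h1 := ih (fun t => h t + 1 * f 0 t) (fun i => f i.succ) (fun i => g i.succ)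
      fun i => hfg i.succ
    have h2 := ih (fun t => h t + -1 * f 0 t) (fun i => f i.succ) (fun i => g i.succ)
      fun i => hfg i.succ
    have h3 := signAvg_mono (n := n)
      (F := fun ε => (⨆ t, (h t + 1 * f 0 t + ∑ i, ε i * g i.succ t))
        + ⨆ t, (h t + -1 * f 0 t + ∑ i, ε i * g i.succ t))
      (G := fun ε => (⨆ t, (h t + 1 * g 0 t + ∑ i, ε i * g i.succ t))
        + ⨆ t, (h t + -1 * g 0 t + ∑ i, ε i * g i.succ t)) fun ε _ => by
        convert ciSup_add_sub_le (fun t => h t + ∑ i, ε i * g i.succ t) (f 0) (g 0) (hfg 0)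
          using 4 <;> ring
    rw [signAvg_add, signAvg_add] at h3
    linarith

/-- Rademacher averages have sub-Gaussian fluctuations: the supremum changes by at most `2` when one
sign is flipped, so its centred exponential moment is at most that of `n` independent signs. -/
lemma signAvg_exp_ciSup_le [Finite T] [Nonempty T] {n : ℕ} (h : T → ℝ) (f : Fin n → T → ℝ)
    (hf : ∀ i t, |f i t| ≤ 1) (l : ℝ) :
    signAvg n (fun ε => Real.exp (l * ⨆ t, (h t + ∑ i, ε i * f i t))) ≤
      Real.exp (l * signAvg n (fun ε => ⨆ t, (h t + ∑ i, ε i * f i t)) + n * (l ^ 2 / 2)) := by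
  induction n generalizing h with
  | zero => simp [signAvg]
  | succ n ih =>
    simp only [signAvg, Fin.sum_univ_succ, Fin.cons_zero, Fin.cons_succ, ← add_assoc]
    have h1 := ih (fun t => h t + 1 * f 0 t) (fun i => f i.succ) fun i => hf i.succ
    have h2 := ih (fun t => h t + -1 * f 0 t) (fun i => f i.succ) fun i => hf i.succ
    have dp := signAvg_mono (n := n)
      (F := fun ε => ⨆ t, (h t + 1 * f 0 t + ∑ i, ε i * f i.succ t))
      (G := fun ε => (⨆ t, (h t + -1 * f 0 t + ∑ i, ε i * f i.succ t)) + 2) fun ε _ =>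
        ciSup_le_ciSup_add fun t => by linarith [(abs_le.1 (hf 0 t)).2]
    have dm := signAvg_mono (n := n)
      (F := fun ε => ⨆ t, (h t + -1 * f 0 t + ∑ i, ε i * f i.succ t))
      (G := fun ε => (⨆ t, (h t + 1 * f 0 t + ∑ i, ε i * f i.succ t)) + 2) fun ε _ =>
        ciSup_le_ciSup_add fun t => by linarith [(abs_le.1 (hf 0 t)).1]
    rw [signAvg_add, signAvg_const] at dp dm
    set p := signAvg n fun ε => ⨆ t, (h t + 1 * f 0 t + ∑ i, ε i * f i.succ t)
    set q := signAvg n fun ε => ⨆ t, (h t + -1 * f 0 t + ∑ i, ε i * f i.succ t)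
    have hd : (l * ((p - q) / 2)) ^ 2 / 2 ≤ l ^ 2 / 2 := by
      have : ((p - q) / 2) ^ 2 ≤ 1 := by nlinarith
      rw [mul_pow]
      nlinarith [sq_nonneg l]
    have hc := (Real.cosh_le_exp_half_sq (l * ((p - q) / 2))).trans (Real.exp_le_exp.2 hd)
    rw [Real.cosh_eq] at hc
    have e1 : Real.exp (l * p + n * (l ^ 2 / 2)) =
        Real.exp (l * ((p + q) / 2) + n * (l ^ 2 / 2)) * Real.exp (l * ((p - q) / 2)) := by
      rw [← Real.exp_add]; ring_nf
    have e2 : Real.exp (l * q + n * (l ^ 2 / 2)) =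
        Real.exp (l * ((p + q) / 2) + n * (l ^ 2 / 2)) * Real.exp (-(l * ((p - q) / 2))) := by
      rw [← Real.exp_add]; ring_nf
    have e3 : Real.exp (l * ((p + q) / 2) + (n + 1 : ℕ) * (l ^ 2 / 2)) =
        Real.exp (l * ((p + q) / 2) + n * (l ^ 2 / 2)) * Real.exp (l ^ 2 / 2) := by
      rw [← Real.exp_add]; push_cast; ring_nf
    rw [e3]
    have := mul_le_mul_of_nonneg_left hc
      (Real.exp_pos (l * ((p + q) / 2) + n * (l ^ 2 / 2))).le
    linarith

variable {E : Type*} [NormedAddCommGroup E] [InnerProductSpace ℝ E]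

lemma signAvg_norm_sq {n : ℕ} (a : E) (z : Fin n → E) :
    signAvg n (fun ε => ‖a + ∑ i, ε i • z i‖ ^ 2) = ‖a‖ ^ 2 + ∑ i, ‖z i‖ ^ 2 := by
  induction n generalizing a with
  | zero => simp [signAvg]
  | succ n ih =>
    simp only [signAvg, Fin.sum_univ_succ, Fin.cons_zero, Fin.cons_succ, ← add_assoc, ih]
    have := parallelogram_law_with_norm ℝ a (z 0)
    simp only [one_smul, neg_smul, ← sub_eq_add_neg]
    linarith

/-- The Rademacher complexity of the linear functions in the unit ball on data of norm at most `R`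
is at most `R √n`. -/
lemma signAvg_linear_le [Nonempty T] {n : ℕ} {R L : ℝ} (hR : 0 ≤ R) (hL : 0 ≤ L) (z : Fin n → E)
    (hz : ∀ i, ‖z i‖ ≤ R) (τ : T → E) (hτ : ∀ t, ‖τ t‖ ≤ 1) :
    signAvg n (fun ε => ⨆ t, (0 + ∑ i, ε i * (L * inner ℝ (z i) (τ t)))) ≤ L * (R * √n) := by
  have h1 : signAvg n (fun ε => ‖(0 : E) + ∑ i, ε i • z i‖) ≤ R * √n := by
    refine (signAvg_le_sqrt _).trans ?_
    rw [signAvg_norm_sq]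
    refine Real.sqrt_le_iff.2 ⟨by positivity, ?_⟩
    rw [mul_pow, Real.sq_sqrt (by positivity)]
    have : ∑ i, ‖z i‖ ^ 2 ≤ ∑ _i : Fin n, R ^ 2 :=
      Finset.sum_le_sum fun i _ => pow_le_pow_left₀ (norm_nonneg _) (hz i) 2
    simp at this ⊢
    linarith
  refine le_trans ?_ (mul_le_mul_of_nonneg_left h1 hL)
  rw [← signAvg_mul_left]
  refine signAvg_mono fun ε _ => ciSup_le fun t => ?_
  have : 0 + ∑ i, ε i * (L * inner ℝ (z i) (τ t))
      = L * inner ℝ ((0 : E) + ∑ i, ε i • z i) (τ t) := by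
    simp only [zero_add, sum_inner, real_inner_smul_left, Finset.mul_sum]
    exact Finset.sum_congr rfl fun i _ => by ring
  rw [this]
  refine mul_le_mul_of_nonneg_left ?_ hL
  refine (real_inner_le_norm _ _).trans ?_
  exact mul_le_of_le_one_right (norm_nonneg _) (hτ t)

/-- Rademacher complexity of a union of finitely many classes: the supremum over the union exceeds
the largest of the individual complexities by at most the price `√(2 n log N)` of `N` sub-Gaussian
variables. -/
lemma signAvg_ciSup_prod_le [Finite T] [Nonempty T] {J : Type*} [Fintype J] [Nonempty J] {n : ℕ}
    (f : Fin n → J × T → ℝ) (hf : ∀ i p, |f i p| ≤ 1) {B : ℝ}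
    (hB : ∀ j, signAvg n (fun ε => ⨆ t, (0 + ∑ i, ε i * f i (j, t))) ≤ B) :
    signAvg n (fun ε => ⨆ p, ∑ i, ε i * f i p) ≤ B + √(2 * n * Real.log (Fintype.card J)) := by
  set N : ℝ := (Fintype.card J : ℝ)
  have hN : 1 ≤ N := Nat.one_le_cast.2 Fintype.card_pos
  set m := signAvg n (fun ε => ⨆ p, ∑ i, ε i * f i p) with hm
  have key : ∀ l : ℝ, 0 ≤ l → l * m ≤ Real.log N + l * B + n * (l ^ 2 / 2) := by
    intro l hl
    rw [← Real.exp_le_exp, Real.exp_add, Real.exp_add, Real.exp_log (by linarith), hm,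
      ← signAvg_mul_left]
    refine (exp_signAvg_le _).trans ?_
    have h1 := signAvg_mono (n := n)
      (F := fun ε => Real.exp (l * ⨆ p, ∑ i, ε i * f i p))
      (G := fun ε => ∑ j, Real.exp (l * ⨆ t, (0 + ∑ i, ε i * f i (j, t)))) fun ε _ => by
        obtain ⟨⟨j, t⟩, hp⟩ := exists_eq_ciSup_of_finite (f := fun p => ∑ i, ε i * f i p)
        rw [← hp]
        refine le_trans ?_ (Finset.single_le_sum
          (f := fun j => Real.exp (l * ⨆ t, (0 + ∑ i, ε i * f i (j, t))))
          (fun j _ => (Real.exp_pos _).le) (Finset.mem_univ j))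
        refine Real.exp_le_exp.2 (mul_le_mul_of_nonneg_left ?_ hl)
        have := le_ciSup (Set.finite_range fun t => 0 + ∑ i, ε i * f i (j, t)).bddAbove t
        simpa using this
    refine h1.trans ?_
    rw [signAvg_sum]
    have h2 : ∀ j ∈ Finset.univ,
        signAvg n (fun ε => Real.exp (l * ⨆ t, (0 + ∑ i, ε i * f i (j, t)))) ≤
          Real.exp (l * B) * Real.exp (n * (l ^ 2 / 2)) := fun j _ => by
      refine (signAvg_exp_ciSup_le (fun _ => 0) (fun i t => f i (j, t))
        (fun i t => hf i (j, t)) l).trans ?_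
      rw [← Real.exp_add]
      exact Real.exp_le_exp.2 (add_le_add_left (mul_le_mul_of_nonneg_left (hB j) hl) _)
    refine (Finset.sum_le_sum h2).trans (le_of_eq ?_)
    rw [Finset.sum_const, nsmul_eq_mul, Finset.card_univ, mul_assoc]
  rcases Nat.eq_zero_or_pos n with rfl | hn
  · have hB0 := hB (Classical.arbitrary J)
    simp only [signAvg, Finset.univ_eq_empty, Finset.sum_empty, add_zero, ciSup_const,
      hm] at hB0 ⊢
    simpa using hB0
  have hn' : (0 : ℝ) < n := by exact_mod_cast hn
  have hlog : 0 ≤ Real.log N := Real.log_nonneg hN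
  rcases hlog.eq_or_lt with h0 | h0
  · -- A single class: the price vanishes, since `l = (m - B) / n` contradicts `B < m`.
    rw [← h0, mul_zero, Real.sqrt_zero, add_zero]
    by_contra! hlt
    have h1 := key ((m - B) / n) (div_nonneg (by linarith) hn'.le)
    rw [← h0] at h1
    have h2 : (m - B) / n * (m - B) ≤ (m - B) / n * (m - B) / 2 := by
      have : (n : ℝ) * (((m - B) / n) ^ 2 / 2) = (m - B) / n * (m - B) / 2 := by
        field_simp
      linarith
    have : 0 < (m - B) / n * (m - B) := mul_pos (div_pos (by linarith) hn') (by linarith)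
    linarith
  · -- The minimiser of `log N / l + n l / 2`.
    set s := √(2 * n * Real.log N) with hs
    have hs0 : 0 < s := Real.sqrt_pos.2 (by positivity)
    have hs2 : s ^ 2 = 2 * n * Real.log N := Real.sq_sqrt (by positivity)
    have h1 := key (s / n) (by positivity)
    have h2 : s / n * (m - B - s) ≤ 0 := by
      have e1 : (n : ℝ) * ((s / n) ^ 2 / 2) = s / n * s / 2 := by field_simp
      have e2 : Real.log N = s / n * s / 2 := by field_simp; linarith
      linarith
    have := nonpos_of_mul_nonpos_right h2 (by positivity)
    linarith

end Suprema

/-! ### Symmetrization -/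

lemma integrable_signAvg {Ω : Type*} [MeasurableSpace Ω] {P : Measure Ω} {n : ℕ}
    {F : (Fin n → ℝ) → Ω → ℝ} (hF : ∀ ε, Integrable (F ε) P) :
    Integrable (fun x => signAvg n fun ε => F ε x) P := by
  induction n with
  | zero => exact hF _
  | succ n ih => exact ((ih fun ε => hF _).add (ih fun ε => hF _)).div_const 2

lemma integral_signAvg {Ω : Type*} [MeasurableSpace Ω] {P : Measure Ω} {n : ℕ}
    {F : (Fin n → ℝ) → Ω → ℝ} (hF : ∀ ε, Integrable (F ε) P) :
    ∫ x, signAvg n (fun ε => F ε x) ∂P = signAvg n fun ε => ∫ x, F ε x ∂P := by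
  induction n with
  | zero => rfl
  | succ n ih =>
    simp only [signAvg]
    rw [integral_div, integral_add (integrable_signAvg fun ε => hF _)
      (integrable_signAvg fun ε => hF _), ih fun ε => hF _, ih fun ε => hF _]

lemma abs_ciSup_le {T : Type*} [Finite T] [Nonempty T] {f : T → ℝ} {c : ℝ} (h : ∀ t, |f t| ≤ c) :
    |⨆ t, f t| ≤ c := by
  obtain ⟨t, ht⟩ := exists_eq_ciSup_of_finite (f := f)
  exact ht ▸ h t

lemma integrable_ciSup {Ω T : Type*} [MeasurableSpace Ω] {P : Measure Ω} [IsFiniteMeasure P]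
    [Finite T] [Nonempty T] {f : T → Ω → ℝ} (hf : ∀ t, Measurable (f t)) {c : ℝ}
    (hc : ∀ t x, |f t x| ≤ c) : Integrable (fun x => ⨆ t, f t x) P :=
  .of_bound (Measurable.iSup hf).aestronglyMeasurable c
    (.of_forall fun x => abs_ciSup_le fun t => hc t x)

/-- Symmetrization: the expected largest deviation of the empirical sums of a finite class of
functions from their means is at most twice any almost sure bound on the Rademacher averages of the
class and of its negative. A second, independent sample replaces the means, and exchanging the two
samples coordinatewise by random signs does not alter their law. -/
lemma integral_ciSup_deviation_le {Z T : Type*} [MeasurableSpace Z] [Finite T] [Nonempty T]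
    (μ : Measure Z) [IsProbabilityMeasure μ] {n : ℕ}
    (φ : T → Z → ℝ) (hφ : ∀ t, Measurable (φ t)) (hφ1 : ∀ t z, |φ t z| ≤ 1) {B : ℝ}
    (hB : ∀ᵐ s ∂(Measure.pi fun _ : Fin n => μ),
      signAvg n (fun ε => ⨆ t, ∑ i, ε i * φ t (s i)) ≤ B ∧
      signAvg n (fun ε => ⨆ t, ∑ i, ε i * -φ t (s i)) ≤ B) :
    ∫ s, (⨆ t, ∑ i, (∫ z, φ t z ∂μ - φ t (s i))) ∂(Measure.pi fun _ : Fin n => μ) ≤ 2 * B := by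
  set π := Measure.pi fun _ : Fin n => μ
  set Q := Measure.pi fun _ : Fin n => μ.prod μ
  have hdiff : ∀ t z z', |φ t z' - φ t z| ≤ 2 := fun t z z' => by
    have h1 := abs_le.1 (hφ1 t z)
    have h2 := abs_le.1 (hφ1 t z')
    exact abs_le.2 ⟨by linarith, by linarith⟩
  set H : (Fin n → ℝ) → (Fin n → Z × Z) → ℝ := fun ε q =>
    ⨆ t, ∑ i, ε i * (φ t (q i).2 - φ t (q i).1) with hH
  have hHint : ∀ ε, Integrable (H ε) Q := fun ε => by
    refine integrable_ciSup (c := ∑ i, |ε i| * 2) (fun t => ?_) fun t q => ?_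
    · exact Finset.measurable_sum _ fun i _ => (((hφ t).comp (by fun_prop)).sub
        ((hφ t).comp (by fun_prop))).const_mul _
    · refine (Finset.abs_sum_le_sum_abs _ _).trans (Finset.sum_le_sum fun i _ => ?_)
      rw [abs_mul]
      exact mul_le_mul_of_nonneg_left (hdiff t _ _) (abs_nonneg _)
  -- The value of `H` for constant signs `1`, at the pairing of a sample with a ghost sample.
  set G : (Fin n → Z) × (Fin n → Z) → ℝ := fun p =>
    ⨆ t, ∑ i, (1 : ℝ) * (φ t (p.2 i) - φ t (p.1 i))
  have hmG : ∀ t, Measurable fun p : (Fin n → Z) × (Fin n → Z) =>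
      ∑ i, (1 : ℝ) * (φ t (p.2 i) - φ t (p.1 i)) := fun t =>
    Finset.measurable_sum _ fun i _ => (((hφ t).comp (by fun_prop)).sub
      ((hφ t).comp (by fun_prop))).const_mul _
  have hbG : ∀ t (p : (Fin n → Z) × (Fin n → Z)),
      |∑ i, (1 : ℝ) * (φ t (p.2 i) - φ t (p.1 i))| ≤ ∑ _i : Fin n, 2 := fun t p =>
    (Finset.abs_sum_le_sum_abs _ _).trans
      (Finset.sum_le_sum fun i _ => by rw [one_mul]; exact hdiff t _ _)
  have hGint : Integrable G (π.prod π) := integrable_ciSup hmG hbG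
  have ghost : ∀ s, ⨆ t, ∑ i, (∫ z, φ t z ∂μ - φ t (s i)) ≤ ∫ s', G (s, s') ∂π := fun s => by
    refine ciSup_le fun t => ?_
    have hi : ∀ i : Fin n, Integrable (fun s' : Fin n → Z => φ t (s' i)) π := fun i =>
      .of_bound ((hφ t).comp (by fun_prop)).aestronglyMeasurable 1 (.of_forall fun _ => hφ1 t _)
    have hd : ∀ i : Fin n, Integrable (fun s' : Fin n → Z => 1 * (φ t (s' i) - φ t (s i))) π :=
      fun i => ((hi i).sub (integrable_const _)).const_mul _
    have h1 : ∑ i, (∫ z, φ t z ∂μ - φ t (s i)) =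
        ∫ s', ∑ i, (1 : ℝ) * (φ t (s' i) - φ t (s i)) ∂π := by
      rw [integral_finsetSum _ fun i _ => hd i]
      refine Finset.sum_congr rfl fun i _ => ?_
      simp only [one_mul]
      rw [integral_sub (hi i) (integrable_const _), integral_const, probReal_univ, one_smul,
        integral_comp_eval (μ := fun _ : Fin n => μ) (i := i) (hφ t).aestronglyMeasurable]
    rw [h1]
    refine integral_mono (integrable_finsetSum _ fun i _ => hd i)
      (integrable_ciSup (fun t => (hmG t).comp (by fun_prop)) fun t s' => hbG t (s, s'))
      fun s' => ?_
    exact le_ciSup (Set.finite_range fun t =>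
      ∑ i, (1 : ℝ) * (φ t (s' i) - φ t (s i))).bddAbove t
  have step : ∫ s, (⨆ t, ∑ i, (∫ z, φ t z ∂μ - φ t (s i))) ∂π ≤ ∫ q, H (fun _ => 1) q ∂Q := by
    have h1 : ∫ q, H (fun _ => 1) q ∂Q = ∫ s, ∫ s', G (s, s') ∂π ∂π := by
      rw [← integral_prod _ hGint]
      exact (measurePreserving_arrowProdEquivProdArrow Z Z (Fin n) (fun _ => μ)
        fun _ => μ).integral_comp' G
    rw [h1]
    refine integral_mono (integrable_ciSup (c := ∑ _i : Fin n, 2) (fun t => ?_) fun t s => ?_)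
      hGint.integral_prod_left ghost
    · exact Finset.measurable_sum _ fun i _ => ((hφ t).comp (by fun_prop)).const_sub _
    · refine (Finset.abs_sum_le_sum_abs _ _).trans (Finset.sum_le_sum fun i _ => ?_)
      have h1 : |∫ z, φ t z ∂μ| ≤ 1 := by
        simpa using norm_integral_le_of_norm_le_const (μ := μ) (f := φ t) (C := 1)
          (.of_forall (hφ1 t))
      have h2 := abs_le.1 h1
      have h3 := abs_le.1 (hφ1 t (s i))
      exact abs_le.2 ⟨by linarith, by linarith⟩
  have swap : ∀ ε : Fin n → ℝ, (∀ i, ε i = 1 ∨ ε i = -1) →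
      ∫ q, H (fun _ => 1) q ∂Q = ∫ q, H ε q ∂Q := fun ε hε => by
    classical
    let g : Fin n → Z × Z → Z × Z := fun i => if ε i = 1 then id else Prod.swap
    have hg : ∀ i, MeasurePreserving (g i) (μ.prod μ) (μ.prod μ) := fun i => by
      by_cases h : ε i = 1
      · simpa [g, h] using MeasurePreserving.id _
      · simpa [g, h] using Measure.measurePreserving_swap
    have hmp : MeasurePreserving (fun (q : Fin n → Z × Z) i => g i (q i)) Q Q :=
      measurePreserving_pi _ _ hg
    have h1 : ∀ q, H ε q = H (fun _ => 1) fun i => g i (q i) := fun q => by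
      simp only [hH]
      congr! 3 with t i
      rcases hε i with h | h
      · simp [g, h]
      · have : ¬ ((-1 : ℝ) = 1) := by norm_num
        simp [g, h, this]
    simp only [h1]
    rw [← hmp.map_eq, integral_map hmp.measurable.aemeasurable, hmp.map_eq]
    rw [hmp.map_eq]
    exact (hHint _).aestronglyMeasurable
  refine step.trans ?_
  rw [← signAvg_const (n := n) (∫ q, H (fun _ => 1) q ∂Q), signAvg_congr swap,
    ← integral_signAvg hHint]
  have hfst : MeasurePreserving (fun (q : Fin n → Z × Z) i => (q i).1) Q π :=
    measurePreserving_pi _ _ fun _ => measurePreserving_fst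
  have hsnd : MeasurePreserving (fun (q : Fin n → Z × Z) i => (q i).2) Q π :=
    measurePreserving_pi _ _ fun _ => measurePreserving_snd
  have hle : ∀ᵐ q ∂Q, signAvg n (fun ε => H ε q) ≤ 2 * B := by
    filter_upwards [hfst.quasiMeasurePreserving.ae hB, hsnd.quasiMeasurePreserving.ae hB]
      with q h1 h2
    refine le_trans ?_ ((add_le_add h2.1 h1.2).trans_eq (two_mul B).symm)
    rw [← signAvg_add]
    refine signAvg_mono fun ε _ => ciSup_le fun t => ?_
    have e : ∑ i, ε i * (φ t (q i).2 - φ t (q i).1) =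
        ∑ i, ε i * φ t (q i).2 + ∑ i, ε i * -φ t (q i).1 := by
      rw [← Finset.sum_add_distrib]
      exact Finset.sum_congr rfl fun i _ => by ring
    rw [e]
    exact add_le_add (le_ciSup (Set.finite_range fun t => ∑ i, ε i * φ t (q i).2).bddAbove t)
      (le_ciSup (Set.finite_range fun t => ∑ i, ε i * -φ t (q i).1).bddAbove t)
  calc ∫ q, signAvg n (fun ε => H ε q) ∂Q ≤ ∫ _q, 2 * B ∂Q :=
        integral_mono_ae (integrable_signAvg hHint) (integrable_const _) hle
    _ = 2 * B := by simp

/-! ### The surrogate class of one client -/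

/-- The ramp loss: `1` for margins at most `θ / 3`, `0` for margins at least `2 θ / 3`, affine in
between. The gaps `θ / 3` on either side leave room for discretizing the classifier. -/
noncomputable def ramp (θ x : ℝ) : ℝ := max 0 (min 1 (2 - 3 / θ * x))

lemma ramp_nonneg (θ x : ℝ) : 0 ≤ ramp θ x := le_max_left _ _

lemma ramp_le_one (θ x : ℝ) : ramp θ x ≤ 1 := max_le zero_le_one (min_le_left _ _)

lemma abs_ramp_le_one (θ x : ℝ) : |ramp θ x| ≤ 1 := by
  rw [abs_of_nonneg (ramp_nonneg θ x)]
  exact ramp_le_one θ x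

lemma continuous_ramp (θ : ℝ) : Continuous (ramp θ) := by
  unfold ramp
  fun_prop

lemma abs_ramp_sub_le {θ : ℝ} (hθ : 0 < θ) (x y : ℝ) :
    |ramp θ x - ramp θ y| ≤ 3 / θ * |x - y| := by
  have h1 := (abs_max_sub_max_le_abs (min 1 (2 - 3 / θ * x)) (min 1 (2 - 3 / θ * y)) 0)
  have h2 := abs_min_sub_min_le_max 1 (2 - 3 / θ * x) 1 (2 - 3 / θ * y)
  have h3 : |2 - 3 / θ * x - (2 - 3 / θ * y)| = 3 / θ * |x - y| := by
    rw [show 2 - 3 / θ * x - (2 - 3 / θ * y) = -(3 / θ * (x - y)) by ring, abs_neg, abs_mul,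
      abs_of_pos (by positivity : 0 < 3 / θ)]
  rw [sub_self, abs_zero, max_eq_right (abs_nonneg _), h3] at h2
  rw [max_comm, max_comm _ (0 : ℝ)] at h1
  exact h1.trans h2

lemma ramp_eq_one {θ x : ℝ} (hθ : 0 < θ) (hx : x ≤ θ / 3) : ramp θ x = 1 := by
  have : 3 / θ * x ≤ 1 := by
    rw [div_mul_eq_mul_div, div_le_one hθ]
    linarith
  rw [ramp, min_eq_left (by linarith), max_eq_right zero_le_one]

lemma ramp_eq_zero {θ x : ℝ} (hθ : 0 < θ) (hx : 2 * θ / 3 ≤ x) : ramp θ x = 0 := by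
  have : 2 ≤ 3 / θ * x := by
    rw [div_mul_eq_mul_div, le_div_iff₀ hθ]
    linarith
  rw [ramp, max_eq_left (min_le_of_right_le (by linarith))]

/-- An interval `[-β, β]` has a `3 θ / 10`-net whose log-cardinality is of order
`log max(1, 4 β / θ)`. The resolution is larger than `θ / 4`, so that a single point suffices not
only when this logarithm is zero but also when it is too small to pay for a second point. -/
lemma exists_finset_grid {θ β : ℝ} (hθ : 0 < θ) :
    ∃ J : Finset ℝ, J.Nonempty ∧ (∀ q, |q| ≤ β → ∃ u ∈ J, |q - u| ≤ 3 * θ / 10) ∧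
      Real.log J.card ≤ 7 * Real.log (max 1 (4 * β / θ)) := by
  rcases le_or_gt β (3 * θ / 10) with h | h
  · refine ⟨{0}, by simp, fun q hq => ⟨0, by simp, by simpa using hq.trans h⟩, ?_⟩
    simpa using Real.log_nonneg (le_max_left 1 (4 * β / θ))
  · set x := 4 * β / θ with hx
    have hx1 : 6 / 5 ≤ x := by
      rw [hx, le_div_iff₀ hθ]
      linarith
    set m := ⌊x / 2 + 1 / 2⌋₊ with hm
    have hm' : (m : ℝ) ≤ x / 2 + 1 / 2 := Nat.floor_le (by linarith)
    refine ⟨(Finset.Icc (-m : ℤ) m).image fun k : ℤ => (k : ℝ) * (θ / 2), ?_, fun q hq => ?_, ?_⟩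
    · simp
    · set k := round (q / (θ / 2)) with hk
      have h1 := abs_sub_round (q / (θ / 2))
      rw [← hk] at h1
      have h2 : |q / (θ / 2)| ≤ x / 2 := by
        rw [abs_div, abs_of_pos (by positivity : 0 < θ / 2), div_le_iff₀ (by positivity), hx]
        field_simp
        linarith
      have h3 : |(k : ℝ)| ≤ x / 2 + 1 / 2 := by
        have := abs_sub_abs_le_abs_sub (k : ℝ) (q / (θ / 2))
        rw [abs_sub_comm] at this
        linarith
      have h4 : k.natAbs ≤ m := Nat.le_floor (by rwa [Nat.cast_natAbs, Int.cast_abs])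
      refine ⟨k * (θ / 2), Finset.mem_image.2 ⟨k, Finset.mem_Icc.2 (by omega), rfl⟩, ?_⟩
      have h5 : q - k * (θ / 2) = (q / (θ / 2) - k) * (θ / 2) := by field_simp
      rw [h5, abs_mul, abs_of_pos (by positivity : 0 < θ / 2)]
      have := mul_le_mul_of_nonneg_right h1 (by positivity : 0 ≤ θ / 2)
      linarith
    · have hne : (Finset.Icc (-m : ℤ) m).Nonempty := by simp
      have hc : (((Finset.Icc (-m : ℤ) m).image fun k : ℤ => (k : ℝ) * (θ / 2)).card : ℝ) ≤
          x * (8 / 3) := by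
        have h1 : ((Finset.Icc (-m : ℤ) m).image fun k : ℤ => (k : ℝ) * (θ / 2)).card ≤
            2 * m + 1 := by
          refine Finset.card_image_le.trans ?_
          rw [Int.card_Icc]
          omega
        have h2 : (((Finset.Icc (-m : ℤ) m).image fun k : ℤ => (k : ℝ) * (θ / 2)).card : ℝ) ≤
            2 * m + 1 := by exact_mod_cast h1
        linarith
      have hpos : (0 : ℝ) < ((Finset.Icc (-m : ℤ) m).image fun k : ℤ => (k : ℝ) * (θ / 2)).card :=
        Nat.cast_pos.2 (hne.image _).card_pos
      -- `8 / 3 ≤ (6 / 5) ^ 6 ≤ x ^ 6`.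
      have h3 : x * (8 / 3) ≤ x ^ 7 := by
        have : (6 / 5 : ℝ) ^ 6 ≤ x ^ 6 := pow_le_pow_left₀ (by norm_num) hx1 6
        have h6 : (8 / 3 : ℝ) ≤ x ^ 6 := le_trans (by norm_num) this
        calc x * (8 / 3) ≤ x * x ^ 6 := mul_le_mul_of_nonneg_left h6 (by linarith)
          _ = x ^ 7 := by ring
      rw [max_eq_right (by linarith)]
      calc Real.log _ ≤ Real.log (x ^ 7) := Real.log_le_log hpos (hc.trans h3)
        _ = 7 * Real.log x := by rw [Real.log_pow]; norm_num

/-- The closed unit ball of `ℝ^d` has finite nets within itself. -/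
lemma exists_finset_net_unit_ball (d : ℕ) {δ : ℝ} (hδ : 0 < δ) :
    ∃ T : Finset (Vec d), T.Nonempty ∧ (∀ t ∈ T, ‖t‖ ≤ 1) ∧
      ∀ w : Vec d, ‖w‖ ≤ 1 → ∃ t ∈ T, ‖w - t‖ ≤ δ := by
  obtain ⟨s, hs, hfin, hcov⟩ :=
    (isCompact_closedBall (0 : Vec d) 1).finite_cover_balls hδ
  have hnet : ∀ w : Vec d, ‖w‖ ≤ 1 → ∃ t ∈ hfin.toFinset, ‖w - t‖ ≤ δ := fun w hw => by
    have h := hcov (mem_closedBall_zero_iff.2 hw)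
    simp only [Set.mem_iUnion, exists_prop, Metric.mem_ball, dist_eq_norm] at h
    obtain ⟨t, ht, h⟩ := h
    exact ⟨t, hfin.mem_toFinset.2 ht, h.le⟩
  refine ⟨hfin.toFinset, ?_, fun t ht => ?_, hnet⟩
  · obtain ⟨t, ht, -⟩ := hnet 0 (by simp)
    exact ⟨t, ht⟩
  · exact mem_closedBall_zero_iff.1 (hs (hfin.mem_toFinset.1 ht))

lemma abs_label (y : Label) : |(y : ℝ)| = 1 := by
  rcases y.2 with h | h
  · rw [h]; norm_num
  · rw [Set.mem_singleton_iff.1 h]; norm_num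

/-- The surrogate of the margin loss of the classifier `v + κ w`: the inner product `⟪x, v + κ w⟫` is
split as `⟪x, v⟫ + κ ⟪b, w⟫ + κ ⟪x - b, w⟫`, a scalar `u` stands for the middle term, and a vector
`t` for `w` in the last one. -/
noncomputable def surrogate {d : ℕ} (θ κ : ℝ) (b v : Vec d) (u : ℝ) (t : Vec d) (z : Datum d) : ℝ :=
  ramp θ ((z.2 : ℝ) * (inner ℝ z.1 v + u + κ * inner ℝ (z.1 - b) t))

lemma measurable_surrogate {d : ℕ} (θ κ : ℝ) (b : Vec d) (u : ℝ) (t : Vec d) :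
    Measurable fun p : Vec d × Datum d => surrogate θ κ b p.1 u t p.2 := by
  unfold surrogate
  refine (continuous_ramp θ).measurable.comp ?_
  fun_prop

/-- The surrogate lies between the 0-1 loss and the 0-1 loss with margin `θ` if the total
discretization error of the margin is at most `θ / 3`. -/
lemma surrogate_mem_Icc {d : ℕ} {θ κ : ℝ} (hθ : 0 < θ) (b v w t : Vec d) (u : ℝ) (z : Datum d)
    (h : |κ * inner ℝ b w - u + κ * inner ℝ (z.1 - b) (w - t)| ≤ θ / 3) :
    surrogate θ κ b v u t z ∈ Set.Icc (marginLoss 0 z (v + κ • w)) (marginLoss θ z (v + κ • w)) := by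
  have e : (z.2 : ℝ) * inner ℝ z.1 (v + κ • w) =
      (z.2 : ℝ) * (inner ℝ z.1 v + u + κ * inner ℝ (z.1 - b) t) +
      (z.2 : ℝ) * (κ * inner ℝ b w - u + κ * inner ℝ (z.1 - b) (w - t)) := by
    simp only [inner_add_right, inner_sub_left, inner_sub_right, real_inner_smul_right]
    ring
  have h' : |(z.2 : ℝ) * (κ * inner ℝ b w - u + κ * inner ℝ (z.1 - b) (w - t))| ≤ θ / 3 := by
    rwa [abs_mul, abs_label, one_mul]
  rw [abs_le] at h'
  unfold marginLoss surrogate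
  constructor
  · split_ifs with h0
    · rw [ramp_eq_one hθ (by linarith)]
    · exact ramp_nonneg _ _
  · split_ifs with h0
    · exact ramp_le_one _ _
    · rw [ramp_eq_zero hθ (by linarith)]

/-- Rademacher averages of the surrogate class (with `σ = 1`) and of its negative (`σ = -1`). For
each offset the class is a contraction of linear functions of `x - b`. -/
lemma signAvg_surrogate_le {d n : ℕ} {θ κ R : ℝ} (hθ : 0 < θ) (hκ : 0 ≤ κ) (hR : 0 ≤ R)
    (b v : Vec d) (J : Finset ℝ) (T : Finset (Vec d)) [Nonempty J] [Nonempty T]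
    (hT : ∀ t ∈ T, ‖t‖ ≤ 1) (s : Fin n → Datum d) (hs : ∀ i, ‖(s i).1 - b‖ ≤ R) {σ : ℝ}
    (hσ : |σ| = 1) :
    signAvg n (fun ε => ⨆ p : J × T, ∑ i, ε i * (σ * surrogate θ κ b v p.1 p.2 (s i))) ≤
      3 * κ / θ * (R * √n) + √(2 * n * Real.log J.card) := by
  rw [← Fintype.card_coe J]
  refine signAvg_ciSup_prod_le (fun i (p : J × T) => σ * surrogate θ κ b v p.1 p.2 (s i))
    (fun i p => ?_) fun u => ?_
  · rw [abs_mul, hσ, one_mul]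
    exact abs_ramp_le_one _ _
  · refine le_trans ?_ (signAvg_linear_le (n := n) hR (by positivity : 0 ≤ 3 * κ / θ)
      (fun i => (s i).1 - b) hs (fun t : T => (t : Vec d)) fun t => hT t t.2)
    refine signAvg_contraction (fun _ => (0 : ℝ))
      (fun i (t : T) => σ * surrogate θ κ b v u t (s i)) _ fun i t t' => ?_
    rw [← mul_sub, ← mul_sub, abs_mul, hσ, one_mul, abs_mul,
      abs_of_nonneg (by positivity : 0 ≤ 3 * κ / θ)]
    refine (abs_ramp_sub_le hθ _ _).trans (le_of_eq ?_)
    rw [← mul_sub, abs_mul, abs_label, one_mul, add_sub_add_left_eq_sub, ← mul_sub, abs_mul,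
      abs_of_nonneg hκ]
    ring

/-- For data within distance `R` of a point `b`, there is a finite class of surrogates, large enough
to sandwich the losses of all classifiers `v + κ w` with `‖w‖ ≤ 1`, and small enough for its expected
largest deviation to be of order `R κ / θ · √n + √(n log max(1, 4 κ ‖b‖ / θ))`, for every fixed `v`. -/
lemma exists_surrogate_class {d n : ℕ} {θ κ R : ℝ} (hθ : 0 < θ) (hκ : 0 < κ) (hR : 0 < R)
    (b : Vec d) (μ : Measure (Datum d)) [IsProbabilityMeasure μ]
    (hμ : ∀ᵐ z ∂μ, ‖z.1 - b‖ ≤ R) :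
    ∃ (J : Finset ℝ) (T : Finset (Vec d)), J.Nonempty ∧ T.Nonempty ∧
      (∀ v w : Vec d, ‖w‖ ≤ 1 → ∃ p : J × T, ∀ z : Datum d, ‖z.1 - b‖ ≤ R →
        surrogate θ κ b v p.1 p.2 z ∈
          Set.Icc (marginLoss 0 z (v + κ • w)) (marginLoss θ z (v + κ • w))) ∧
      ∀ v : Vec d, ∫ s, (⨆ p : J × T, ∑ i : Fin n, (∫ z, surrogate θ κ b v p.1 p.2 z ∂μ
          - surrogate θ κ b v p.1 p.2 (s i))) ∂(Measure.pi fun _ => μ) ≤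
        2 * (3 * κ / θ * (R * √n) +
          √(2 * n * (7 * Real.log (max 1 (4 * (κ * ‖b‖) / θ))))) := by
  obtain ⟨J, hJ, hJnet, hJcard⟩ := exists_finset_grid (β := κ * ‖b‖) hθ
  obtain ⟨T, hT, hT1, hTnet⟩ :=
    exists_finset_net_unit_ball d (by positivity : 0 < θ / (30 * (κ * R)))
  have := hJ.to_subtype
  have := hT.to_subtype
  refine ⟨J, T, hJ, hT, fun v w hw => ?_, fun v => ?_⟩
  · obtain ⟨u, hu, hu'⟩ := hJnet (κ * inner ℝ b w) <| by
      rw [abs_mul, abs_of_pos hκ]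
      exact mul_le_mul_of_nonneg_left ((abs_real_inner_le_norm _ _).trans
        (mul_le_of_le_one_right (norm_nonneg _) hw)) hκ.le
    obtain ⟨t, ht, ht'⟩ := hTnet w hw
    refine ⟨(⟨u, hu⟩, ⟨t, ht⟩), fun z hz => surrogate_mem_Icc hθ b v w t u z ?_⟩
    have h1 : |κ * inner ℝ (z.1 - b) (w - t)| ≤ θ / 30 := by
      rw [abs_mul, abs_of_pos hκ]
      calc κ * |inner ℝ (z.1 - b) (w - t)| ≤ κ * (R * (θ / (30 * (κ * R)))) :=
            mul_le_mul_of_nonneg_left ((abs_real_inner_le_norm _ _).trans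
              (mul_le_mul hz ht' (norm_nonneg _) hR.le)) hκ.le
        _ = θ / 30 := by field_simp
    exact (abs_add_le _ _).trans (by linarith)
  · refine integral_ciSup_deviation_le μ (fun p : J × T => surrogate θ κ b v p.1 p.2)
      (fun p => (measurable_surrogate θ κ b p.1 p.2).comp measurable_prodMk_left)
      (fun p z => abs_ramp_le_one _ _) ?_
    have hs : ∀ᵐ s ∂(Measure.pi fun _ : Fin n => μ), ∀ i, ‖(s i).1 - b‖ ≤ R :=
      Filter.eventually_all.2 fun i =>
        (measurePreserving_eval (fun _ : Fin n => μ) i).quasiMeasurePreserving.ae hμ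
    filter_upwards [hs] with s hs
    have hle : 3 * κ / θ * (R * √n) + √(2 * n * Real.log J.card) ≤ 3 * κ / θ * (R * √n) +
        √(2 * n * (7 * Real.log (max 1 (4 * (κ * ‖b‖) / θ)))) := by gcongr
    constructor
    · simpa using (signAvg_surrogate_le hθ hκ.le hR.le b v J T hT1 s hs
        (σ := 1) (by norm_num)).trans hle
    · simpa using (signAvg_surrogate_le hθ hκ.le hR.le b v J T hT1 s hs
        (σ := -1) (by norm_num)).trans hle

/-! ### Measurability and boundedness of the risks -/

lemma measurable_marginLoss {d : ℕ} (γ : ℝ) :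
    Measurable fun p : Datum d × Vec d => marginLoss γ p.1 p.2 := by
  unfold marginLoss
  refine Measurable.ite (measurableSet_lt ?_ measurable_const) measurable_const measurable_const
  fun_prop

lemma marginLoss_mem_Icc {d : ℕ} (γ : ℝ) (z : Datum d) (w : Vec d) :
    marginLoss γ z w ∈ Set.Icc (0 : ℝ) 1 := by
  unfold marginLoss
  split_ifs <;> simp

lemma measurable_popRisk {d : ℕ} (μ : Measure (Datum d)) [SFinite μ] : Measurable (popRisk μ) :=
  ((measurable_marginLoss 0).comp measurable_swap).stronglyMeasurable.integral_prod_right'.measurable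

lemma integrable_marginLoss {d : ℕ} (μ : Measure (Datum d)) [IsFiniteMeasure μ] (γ : ℝ) (w : Vec d) :
    Integrable (fun z => marginLoss γ z w) μ :=
  .of_bound ((measurable_marginLoss γ).comp measurable_prodMk_right).aestronglyMeasurable 1
    (.of_forall fun z => abs_le.2
      ⟨by linarith [(marginLoss_mem_Icc γ z w).1], (marginLoss_mem_Icc γ z w).2⟩)

lemma popRisk_mem_Icc {d : ℕ} (μ : Measure (Datum d)) [IsProbabilityMeasure μ] (w : Vec d) :
    popRisk μ w ∈ Set.Icc (0 : ℝ) 1 := by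
  refine ⟨integral_nonneg fun z => (marginLoss_mem_Icc 0 z w).1, ?_⟩
  refine (integral_mono (integrable_marginLoss μ 0 w) (integrable_const 1)
    fun z => (marginLoss_mem_Icc 0 z w).2).trans_eq ?_
  simp

lemma empRisk_mem_Icc {d n : ℕ} (θ : ℝ) (s : Fin n → Datum d) (w : Vec d) :
    empRisk θ s w ∈ Set.Icc (0 : ℝ) 1 := by
  unfold empRisk
  have h0 : 0 ≤ ∑ i, marginLoss θ (s i) w :=
    Finset.sum_nonneg fun i _ => (marginLoss_mem_Icc θ (s i) w).1
  refine ⟨by positivity, ?_⟩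
  have h1 : ∑ i, marginLoss θ (s i) w ≤ ∑ _i : Fin n, (1 : ℝ) :=
    Finset.sum_le_sum fun i _ => (marginLoss_mem_Icc θ (s i) w).2
  rw [Finset.sum_const, Finset.card_univ, Fintype.card_fin, nsmul_eq_mul, mul_one] at h1
  rw [one_div, inv_mul_eq_div]
  exact div_le_one_of_le₀ h1 (Nat.cast_nonneg n)

lemma measurable_aggregate {d K : ℕ} : Measurable (aggregate : (Fin K → Vec d) → Vec d) := by
  unfold aggregate
  fun_prop

lemma integrable_clientGen {d n K : ℕ} (θ : ℝ) (μ : Measure (Datum d)) [IsProbabilityMeasure μ]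
    (P : Measure (Fin K → (Fin n → Datum d) × Vec d)) [IsFiniteMeasure P] (k : Fin K) :
    Integrable (fun ω => popRisk μ (aggregate fun j => (ω j).2)
      - empRisk θ (ω k).1 (aggregate fun j => (ω j).2)) P := by
  have hagg : Measurable fun ω : Fin K → (Fin n → Datum d) × Vec d =>
      aggregate fun j => (ω j).2 := measurable_aggregate.comp (by fun_prop)
  refine .of_bound (Measurable.aestronglyMeasurable ?_) 1 (.of_forall fun ω => ?_)
  · refine ((measurable_popRisk μ).comp hagg).sub ?_
    unfold empRisk
    refine (Finset.measurable_sum _ fun i _ => ?_).const_mul _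
    exact (measurable_marginLoss θ).comp (Measurable.prodMk (by fun_prop) hagg)
  · have h1 := popRisk_mem_Icc μ (aggregate fun j => (ω j).2)
    have h2 := empRisk_mem_Icc θ (ω k).1 (aggregate fun j => (ω j).2)
    exact abs_le.2 ⟨by linarith [h1.1, h2.2], by linarith [h1.2, h2.1]⟩

/-! ### The generalization error of one client -/

instance {d n : ℕ} (μ : Measure (Datum d)) [IsProbabilityMeasure μ]
    (A : Kernel (Fin n → Datum d) (Vec d)) [IsMarkovKernel A] :
    IsProbabilityMeasure (clientLaw μ A) := by
  unfold clientLaw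
  infer_instance

lemma measurePreserving_fst_clientLaw {d n : ℕ} (μ : Measure (Datum d)) [IsProbabilityMeasure μ]
    (A : Kernel (Fin n → Datum d) (Vec d)) [IsMarkovKernel A] :
    MeasurePreserving Prod.fst (clientLaw μ A) (Measure.pi fun _ => μ) :=
  ⟨measurable_fst, Measure.fst_compProd _ _⟩

/-- The expected contribution of client `k`. Conditionally on the other clients, the aggregated
model is `v + K⁻¹ w` with `v` fixed and `w` the model of client `k`, so that it is covered by a
surrogate class which does not depend on the data of client `k`. -/
lemma integral_clientGen_le {d n K : ℕ} (hn : 0 < n) {θ R : ℝ} (hθ : 0 < θ) (hR : 0 < R)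
    (μ : Fin K → Measure (Datum d)) (hμ : ∀ k, IsProbabilityMeasure (μ k))
    (A : Fin K → Kernel (Fin n → Datum d) (Vec d)) (hA : ∀ k, IsMarkovKernel (A k)) (k : Fin K)
    (hW : ∀ᵐ p ∂(clientLaw (μ k) (A k)), ‖p.2‖ ≤ 1) (b : Vec d)
    (hb : ∀ᵐ z ∂(μ k), ‖z.1 - b‖ ≤ R) :
    ∫ ω, (popRisk (μ k) (aggregate fun j => (ω j).2)
        - empRisk θ (ω k).1 (aggregate fun j => (ω j).2)) ∂(systemLaw μ A) ≤
      1 / n * (2 * (3 * (1 / K) / θ * (R * √n) +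
        √(2 * n * (7 * Real.log (max 1 (4 * (1 / K * ‖b‖) / θ)))))) := by
  obtain ⟨K, rfl⟩ : ∃ K', K = K' + 1 := ⟨K - 1, by have := k.pos; omega⟩
  set κ : ℝ := 1 / ((K + 1 : ℕ) : ℝ)
  have hκ : 0 < κ := by positivity
  obtain ⟨J, T, hJ, hT, hcover, hdev⟩ := exists_surrogate_class (n := n) hθ hκ hR b (μ k) hb
  have := hJ.to_subtype
  have := hT.to_subtype
  have hP : IsProbabilityMeasure (systemLaw μ A) := by
    unfold systemLaw
    infer_instance
  set S := J × T
  set ψ : Vec d → S → Datum d → ℝ := fun v p => surrogate θ κ b v p.1 p.2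
  have hψm : ∀ p, Measurable fun q : Vec d × Datum d => ψ q.1 p q.2 := fun p =>
    measurable_surrogate θ κ b p.1 p.2
  have hψ0 : ∀ v p z, 0 ≤ ψ v p z := fun v p z => ramp_nonneg _ _
  have hψ1 : ∀ v p z, ψ v p z ≤ 1 := fun v p z => ramp_le_one _ _
  have hψint : ∀ v p, Integrable (ψ v p) (μ k) := fun v p =>
    .of_bound ((hψm p).comp measurable_prodMk_left).aestronglyMeasurable 1
      (.of_forall fun z => abs_ramp_le_one _ _)
  set G : Vec d → (Fin n → Datum d) → ℝ := fun v s =>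
    ⨆ p : S, ∑ i, (∫ z, ψ v p z ∂(μ k) - ψ v p (s i))
  -- The part of the aggregated model that does not depend on client `k`.
  set V : (Fin K → (Fin n → Datum d) × Vec d) → Vec d := fun ω => κ • ∑ j, (ω j).2 with hV
  have hagg : ∀ ω : Fin (K + 1) → (Fin n → Datum d) × Vec d,
      aggregate (fun j => (ω j).2) = V (fun j => ω (k.succAbove j)) + κ • (ω k).2 := fun ω => by
    rw [aggregate, Fin.sum_univ_succAbove _ k, smul_add, add_comm]
  set F : ((Fin n → Datum d) × Vec d) × (Fin K → (Fin n → Datum d) × Vec d) → ℝ :=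
    fun q => G (V q.2) q.1.1
  have hFint : Integrable F ((clientLaw (μ k) (A k)).prod
      (Measure.pi fun j => clientLaw (μ (k.succAbove j)) (A (k.succAbove j)))) := by
    have hVm : Measurable V := by
      rw [hV]
      fun_prop
    refine integrable_ciSup (c := ∑ _i : Fin n, 1) (fun p => ?_) fun p q => ?_
    · refine Finset.measurable_sum _ fun i _ => Measurable.sub ?_ ?_
      · exact (hψm p).stronglyMeasurable.integral_prod_right'.measurable.comp
          (hVm.comp measurable_snd)
      · exact (hψm p).comp (Measurable.prodMk (hVm.comp measurable_snd) (by fun_prop))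
    · refine (Finset.abs_sum_le_sum_abs _ _).trans (Finset.sum_le_sum fun i _ => ?_)
      have h1 : 0 ≤ ∫ z, ψ (V q.2) p z ∂(μ k) := integral_nonneg (hψ0 _ p)
      have h2 : ∫ z, ψ (V q.2) p z ∂(μ k) ≤ 1 :=
        (integral_mono (hψint _ p) (integrable_const 1) (hψ1 _ p)).trans_eq (by simp)
      exact abs_le.2 ⟨by linarith [hψ1 (V q.2) p (q.1.1 i)],
        by linarith [hψ0 (V q.2) p (q.1.1 i)]⟩
  have hmp := measurePreserving_piFinSuccAbove (fun j => clientLaw (μ j) (A j)) k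
  have hle : ∀ᵐ ω ∂(systemLaw μ A), popRisk (μ k) (aggregate fun j => (ω j).2)
      - empRisk θ (ω k).1 (aggregate fun j => (ω j).2) ≤
        1 / n * F (MeasurableEquiv.piFinSuccAbove (fun _ => (Fin n → Datum d) × Vec d) k ω) := by
    have heval := measurePreserving_eval (fun j => clientLaw (μ j) (A j)) k
    have hs : ∀ᵐ p ∂(clientLaw (μ k) (A k)), ∀ i, ‖(p.1 i).1 - b‖ ≤ R :=
      (measurePreserving_fst_clientLaw (μ k) (A k)).quasiMeasurePreserving.ae
        (Filter.eventually_all.2 fun i =>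
          (measurePreserving_eval (fun _ : Fin n => μ k) i).quasiMeasurePreserving.ae hb)
    filter_upwards [heval.quasiMeasurePreserving.ae hW, heval.quasiMeasurePreserving.ae hs]
      with ω h1 h2
    rw [hagg]
    set v := V fun j => ω (k.succAbove j)
    obtain ⟨p, hp⟩ := hcover v (ω k).2 h1
    have hpop : popRisk (μ k) (v + κ • (ω k).2) ≤ ∫ z, ψ v p z ∂(μ k) :=
      integral_mono_ae (integrable_marginLoss (μ k) 0 _) (hψint v p)
        (hb.mono fun z hz => (hp z hz).1)
    have hemp : 1 / (n : ℝ) * ∑ i, ψ v p ((ω k).1 i) ≤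
        empRisk θ (ω k).1 (v + κ • (ω k).2) :=
      mul_le_mul_of_nonneg_left (Finset.sum_le_sum fun i _ => (hp _ (h2 i)).2) (by positivity)
    have hsup : ∑ i, (∫ z, ψ v p z ∂(μ k) - ψ v p ((ω k).1 i)) ≤ G v (ω k).1 :=
      le_ciSup (Set.finite_range fun p : S =>
        ∑ i, (∫ z, ψ v p z ∂(μ k) - ψ v p ((ω k).1 i))).bddAbove p
    have hmul := mul_le_mul_of_nonneg_left hsup (by positivity : 0 ≤ 1 / (n : ℝ))
    rw [Finset.sum_sub_distrib, Finset.sum_const, Finset.card_univ, Fintype.card_fin,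
      nsmul_eq_mul, mul_sub, ← mul_assoc, one_div_mul_cancel (by positivity), one_mul] at hmul
    have hFeq : F (MeasurableEquiv.piFinSuccAbove (fun _ => (Fin n → Datum d) × Vec d) k ω) =
      G v (ω k).1 := rfl
    rw [hFeq]
    linarith
  have hFcomp : Integrable (fun ω => F (MeasurableEquiv.piFinSuccAbove
      (fun _ => (Fin n → Datum d) × Vec d) k ω)) (systemLaw μ A) :=
    hmp.integrable_comp_of_integrable hFint
  refine (integral_mono_ae (integrable_clientGen θ (μ k) _ k) (hFcomp.const_mul _) hle).trans ?_
  rw [integral_const_mul]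
  refine mul_le_mul_of_nonneg_left ?_ (by positivity)
  have hcomp : ∫ ω, F (MeasurableEquiv.piFinSuccAbove
      (fun _ => (Fin n → Datum d) × Vec d) k ω) ∂(systemLaw μ A) = ∫ q, F q ∂_ :=
    hmp.integral_comp' F
  rw [hcomp, integral_prod_symm _ hFint]
  have hinner : ∀ ω', ∫ x, F (x, ω') ∂(clientLaw (μ k) (A k)) ≤
      2 * (3 * κ / θ * (R * √n) + √(2 * n * (7 * Real.log (max 1 (4 * (κ * ‖b‖) / θ))))) :=
    fun ω' => by
      have hmpf := measurePreserving_fst_clientLaw (μ k) (A k)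
      have hGm : Measurable (G (V ω')) := Measurable.iSup fun p =>
        Finset.measurable_sum _ fun i _ => Measurable.const_sub
          (((hψm p).comp measurable_prodMk_left).comp (measurable_pi_apply i)) _
      have h1 : ∫ x, F (x, ω') ∂(clientLaw (μ k) (A k)) =
          ∫ s, G (V ω') s ∂(Measure.pi fun _ : Fin n => μ k) := by
        rw [← hmpf.map_eq, integral_map hmpf.measurable.aemeasurable hGm.aestronglyMeasurable]
      exact h1.trans_le (hdev (V ω'))
  exact (integral_mono hFint.integral_prod_right (integrable_const _) hinner).trans_eq (by simp)

/-! ### The heterogeneity setup -/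

lemma isProbabilityMeasure_setupDist {d K M : ℕ} (r : ℕ) (ν : Fin M → Measure (Datum d))
    (hν : ∀ m, IsProbabilityMeasure (ν m)) (α : Fin K → Fin M → ℝ≥0) (k : Fin K)
    (hα : ∑ m ∈ window M r k, α k m = 1) : IsProbabilityMeasure (setupDist r ν α k) := by
  constructor
  simp only [setupDist, Measure.finsetSum_apply, Measure.smul_apply, measure_univ]
  simp only [ENNReal.smul_def, smul_eq_mul, mul_one]
  exact_mod_cast congrArg ((↑) : ℝ≥0 → ENNReal) hα

lemma norm_sub_le_spread {d K M : ℕ} (r : ℕ) (a : Fin M → Vec d) (k : Fin K) {m m' : Fin M}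
    (hm : m ∈ window M r k) (hm' : m' ∈ window M r k) : ‖a m - a m'‖ ≤ spread r a k := by
  have hmem : (m, m') ∈ window M r k ×ˢ window M r k := Finset.mk_mem_product hm hm'
  have h := Finset.le_sup (f := fun p : Fin M × Fin M => ‖a p.1 - a p.2‖₊) hmem
  rw [spread, ← coe_nnnorm]
  exact NNReal.coe_le_coe.2 h

/-- The data of client `k` lie within distance `ρ + spread` of the mean of the centers. -/
lemma ae_norm_sub_center_le {d K M : ℕ} (r : ℕ) {ρ : ℝ} (a : Fin M → Vec d)
    (ν : Fin M → Measure (Datum d)) (hν : ∀ m, ∀ᵐ z ∂(ν m), ‖z.1 - a m‖ ≤ ρ)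
    (α : Fin K → Fin M → ℝ≥0) (k : Fin K) (hα : ∑ m ∈ window M r k, α k m = 1) :
    ∀ᵐ z ∂(setupDist r ν α k), ‖z.1 - center r a α k‖ ≤ ρ + spread r a k := by
  rw [setupDist, ae_finsetSum_measure_iff]
  refine fun m hm => Measure.ae_smul_measure ?_ _
  filter_upwards [hν m] with z hz
  have hα' : ∑ m' ∈ window M r k, (α k m' : ℝ) = 1 := by exact_mod_cast hα
  have h1 : z.1 - center r a α k =
      (z.1 - a m) + ∑ m' ∈ window M r k, (α k m' : ℝ) • (a m - a m') := by
    simp only [smul_sub, Finset.sum_sub_distrib, ← Finset.sum_smul, hα', one_smul, center]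
    abel
  have h2 : ∀ m' ∈ window M r k, ‖(α k m' : ℝ) • (a m - a m')‖ ≤ α k m' * spread r a k :=
    fun m' hm' => by
      rw [norm_smul_of_nonneg (NNReal.coe_nonneg (α k m'))]
      refine mul_le_mul_of_nonneg_left ?_ (NNReal.coe_nonneg (α k m'))
      exact norm_sub_le_spread r a k hm hm'
  rw [h1]
  refine (norm_add_le _ _).trans (add_le_add hz ((norm_sum_le_of_le _ h2).trans_eq ?_))
  rw [← Finset.sum_mul, hα', one_mul]

/-! ### Averaging over the clients -/

/-- Comparison of the bound for one client with the summand of the final bound; the product of the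
two logarithms is bounded below by `log 2 ≥ 1 / 2`. -/
lemma client_bound_le {n K : ℕ} (hnK : 2 ≤ n * K) {θ R β : ℝ} (hθ : 0 < θ) (hR : 0 < R)
    (hβ : 0 ≤ β) :
    1 / n * (2 * (3 * (1 / K) / θ * (R * √n) +
        √(2 * n * (7 * Real.log (max 1 (4 * (1 / K * β) / θ)))))) ≤
      12 * √(((R / (K * θ)) ^ 2 * Real.log (n * K) * Real.log (max 3 (K * θ / R))
        + Real.log (max 1 (4 * n * β / (K * θ)))) / n) := by
  have hn : 0 < n := Nat.pos_of_ne_zero (by rintro rfl; simp at hnK)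
  have hK : 0 < K := Nat.pos_of_ne_zero (by rintro rfl; simp at hnK)
  have hn' : (1 : ℝ) ≤ n := by exact_mod_cast hn
  have hK' : (0 : ℝ) < K := by exact_mod_cast hK
  set r := R / (K * θ) with hr
  set L := Real.log (max 1 (4 * (1 / K * β) / θ)) with hL
  set L' := Real.log (max 1 (4 * n * β / (K * θ))) with hL'
  have hL0 : 0 ≤ L := Real.log_nonneg (le_max_left _ _)
  have hLL : L ≤ L' := by
    refine Real.log_le_log (by positivity) (max_le_max le_rfl ?_)
    rw [show 4 * (1 / K * β) / θ = 4 * 1 * β / (K * θ) by field_simp]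
    gcongr
  have hlog1 : 1 / 2 ≤ Real.log (n * K) := by
    have h2 : (2 : ℝ) ≤ n * K := by exact_mod_cast hnK
    have := Real.log_le_log (by norm_num) h2
    linarith [Real.log_two_gt_d9]
  have hlog2 : 1 ≤ Real.log (max 3 (K * θ / R)) := by
    rw [Real.le_log_iff_exp_le (by positivity)]
    exact le_max_of_le_left (by linarith [Real.exp_one_lt_d9])
  have hlog : r ^ 2 * (1 / 2) ≤ r ^ 2 * Real.log (n * K) * Real.log (max 3 (K * θ / R)) := by
    rw [mul_assoc]
    refine mul_le_mul_of_nonneg_left ?_ (sq_nonneg _)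
    nlinarith
  set X := r ^ 2 * Real.log (n * K) * Real.log (max 3 (K * θ / R))
  have hX : 0 ≤ X := le_trans (by positivity) hlog
  have hsn : √(n : ℝ) ^ 2 = n := Real.sq_sqrt (by positivity)
  have hs : √(2 * n * (7 * L)) ^ 2 = 2 * n * (7 * L) := Real.sq_sqrt (by positivity)
  have h3 : 3 * (1 / K) / θ * (R * √n) = 3 * r * √n := by
    rw [hr]
    field_simp
  rw [h3]
  set p := 3 * r * √(n : ℝ) with hp
  set q := √(2 * n * (7 * L))
  have hp2 : p ^ 2 = 9 * r ^ 2 * n := by rw [hp, mul_pow, hsn]; ring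
  rw [← Real.sqrt_sq (by norm_num : (0 : ℝ) ≤ 12), ← Real.sqrt_mul (by positivity)]
  refine Real.le_sqrt_of_sq_le ?_
  have hsq : (1 / (n : ℝ) * (2 * (p + q))) ^ 2 = 4 * (p + q) ^ 2 / n / n := by
    field_simp
    ring
  rw [hsq, ← mul_div_assoc]
  refine div_le_div_of_nonneg_right ?_ (by positivity)
  rw [div_le_iff₀ (by positivity)]
  have h4 : (p + q) ^ 2 ≤ 2 * (9 * r ^ 2 * n + 2 * n * (7 * L)) := by
    nlinarith [sq_nonneg (p - q)]
  have h5 : 9 * r ^ 2 + 14 * L ≤ 18 * (X + L') := by linarith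
  nlinarith

/-- Concavity of the square root. -/
lemma mean_sqrt_le {n K : ℕ} (Q : Fin K → ℝ) (hQ : ∀ k, 0 ≤ Q k) :
    1 / (K : ℝ) * ∑ k, √(Q k / n) ≤ √((∑ k, Q k) / (n * K)) := by
  refine Real.le_sqrt_of_sq_le ?_
  have h1 := sq_sum_le_card_mul_sum_sq (s := Finset.univ) (f := fun k => √(Q k / n))
  simp only [fun k => Real.sq_sqrt (div_nonneg (hQ k) (Nat.cast_nonneg n)), Finset.card_univ,
    Fintype.card_fin, ← Finset.sum_div] at h1
  rcases K.eq_zero_or_pos with rfl | hK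
  · simp
  have hK' : (0 : ℝ) < K := by exact_mod_cast hK
  calc (1 / (K : ℝ) * ∑ k, √(Q k / n)) ^ 2 = (1 / (K : ℝ)) ^ 2 * (∑ k, √(Q k / n)) ^ 2 := by
        rw [mul_pow]
    _ ≤ (1 / (K : ℝ)) ^ 2 * (K * ((∑ k, Q k) / n)) := by gcongr
    _ = (∑ k, Q k) / (n * K) := by
        rw [← div_div]
        field_simp

end DSVM

theorem theorem8 :
    ∃ C : ℝ, 0 < C ∧
      ∀ (d n K M r : ℕ), 2 ≤ n * K → 1 ≤ r → r ≤ M →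
      ∀ (θ ρ : ℝ), 0 < θ → θ ≤ 1 → 0 < ρ →
      ∀ (a : Fin M → DSVM.Vec d) (ν : Fin M → Measure (DSVM.Datum d)),
        (∀ m, IsProbabilityMeasure (ν m)) →
        (∀ m, ∀ᵐ z ∂(ν m), ‖z.1 - a m‖ ≤ ρ) →
      ∀ (α : Fin K → Fin M → ℝ≥0),
        (∀ k, ∑ m ∈ DSVM.window M r k, α k m = 1) →
      ∀ (A : Fin K → Kernel (Fin n → DSVM.Datum d) (DSVM.Vec d)),
        (∀ k, IsMarkovKernel (A k)) →
        (∀ k, ∀ᵐ p ∂(DSVM.clientLaw (DSVM.setupDist r ν α k) (A k)), ‖p.2‖ ≤ 1) →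
      Integrable (DSVM.genError θ (DSVM.setupDist r ν α))
          (DSVM.systemLaw (DSVM.setupDist r ν α) A) ∧
      ∫ ω, DSVM.genError θ (DSVM.setupDist r ν α) ω
          ∂(DSVM.systemLaw (DSVM.setupDist r ν α) A) ≤
        C * Real.sqrt ((∑ k : Fin K,
          (((ρ + DSVM.spread r a k) / (K * θ)) ^ 2 * Real.log (n * K)
              * Real.log (max 3 (K * θ / (ρ + DSVM.spread r a k)))
            + Real.log (max 1 (4 * n * ‖DSVM.center r a α k‖ / (K * θ)))))
          / (n * K)) := by
  refine ⟨12, by norm_num, fun d n K M r hnK _ _ θ ρ hθ _ hρ a ν hν hνa α hα A hA hW => ?_⟩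
  have hn : 0 < n := Nat.pos_of_ne_zero (by rintro rfl; simp at hnK)
  have hμ : ∀ k, IsProbabilityMeasure (DSVM.setupDist r ν α k) := fun k =>
    DSVM.isProbabilityMeasure_setupDist r ν hν α k (hα k)
  have hP : IsProbabilityMeasure (DSVM.systemLaw (DSVM.setupDist r ν α) A) := by
    unfold DSVM.systemLaw
    infer_instance
  have hint := fun k => DSVM.integrable_clientGen θ (DSVM.setupDist r ν α k)
    (DSVM.systemLaw (DSVM.setupDist r ν α) A) k
  refine ⟨(integrable_finsetSum _ fun k _ => hint k).const_mul _, ?_⟩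
  have hR : ∀ k : Fin K, 0 < ρ + DSVM.spread r a k := fun k =>
    add_pos_of_pos_of_nonneg hρ (NNReal.coe_nonneg _)
  have hclient := fun k => (DSVM.integral_clientGen_le hn hθ (hR k) _ hμ A hA k (hW k)
    (DSVM.center r a α k) (DSVM.ae_norm_sub_center_le r a ν hνa α k (hα k))).trans
    (DSVM.client_bound_le hnK hθ (hR k) (norm_nonneg _))
  unfold DSVM.genError
  rw [integral_const_mul, integral_finsetSum _ fun k _ => hint k]
  refine (mul_le_mul_of_nonneg_left (Finset.sum_le_sum fun k _ => hclient k)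
    (by positivity)).trans ?_
  rw [← Finset.mul_sum, mul_left_comm]
  refine mul_le_mul_of_nonneg_left (DSVM.mean_sqrt_le _ fun k => ?_) (by norm_num)
  refine add_nonneg (mul_nonneg (mul_nonneg (sq_nonneg _) (Real.log_nonneg ?_))
    (Real.log_nonneg ?_)) (Real.log_nonneg (le_max_left _ _))
  · exact_mod_cast (by omega : 1 ≤ n * K)
  · exact le_max_of_le_left (by norm_num)
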